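/- Let $d\ge 1$, $\alpha>0$, $T>0$. Let $(-\Delta)^{s}$ be the Fourier multiplier with symbol $|\xi|^{2s}$ (for the transform with kernel $e^{-ix\cdot\xi}$), and let $H^\alpha=H^\alpha(\mathbb R^d)=\{v\in L^2(\mathbb R^d;\mathbb C):(-\Delta)^{\alpha/2}v\in L^2\}$ with norm $\|v\|_{H^\alpha}=\|v\|_{L^2}+\|(-\Delta)^{\alpha/2}v\|_{L^2}$. Let $(u_0,u_1)\in H^\alpha\times L^2(\mathbb R^d)$. For a real function $a\in L^\infty(\mathbb R^d)$, a solution of the Cauchy problem with mass $a$, $$w_{tt}+(-\Delta)^\alpha w+a(x)w=0 \ \text{ in } (0,T)\times\mathbb R^d,\qquad w(0)=u_0,\quad w_t(0)=u_1,$$ means a function $w\in C([0,T];H^\alpha)\cap C^1([0,T];L^2)$ with these initial values such that, for every $v\in H^\alpha$ and every $t\in(0,T)$, the function $\langle w_t(\cdot),v\rangle_{L^2}$ is differentiable at $t$ and $$\frac{d}{dt}\langle w_t(t),v\rangle_{L^2}+\langle(-\Delta)^{\alpha/2}w(t),(-\Delta)^{\alpha/2}v\rangle_{L^2}+\langle a\,w(t),v\rangle_{L^2}=0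 .$$ Let $m\in L^\infty(\mathbb R^d)$ be real-valued with $m\ge 0$ almost everywhere, and let $u$ be the classical solution, i.e. the solution with mass $m$. Let $\psi\in C_0^\infty(\mathbb R^d)$ satisfy $\psi\ge 0$ and $\int\psi=1$, and put $\psi_\varepsilon(x)=\varepsilon^{-d}\psi(x/\varepsilon)$ and $m_\varepsilon=m*\psi_\varepsilon$ for $\varepsilon\in(0,1]$. Let $(u_\varepsilon)_{\varepsilon\in(0,1]}$ be a very weak solution given by the regularisation $(m_\varepsilon)$; that is: 1. $(m_\varepsilon)$ is $L^\infty$-moderate: there are $N\in\mathbb N_0$, $c>0$ with $\|m_\varepsilon\|_{L^\infty}\le c\,\varepsilon^{-N}$ for all $\varepsilon\in(0,1]$; 2. for each $\varepsilon\in(0,1]$, $u_\varepsilon$ is a solution with mass $m_\varepsilon$ and data $(u_0,u_1)$; 3. $(u_\varepsilon)$ is $C^1$-moderate: there are $N\in\mathbb N_0$, $c>0$ with $\sup_{t\in[0,T]}\big(\|u_\varepsilon(t)\|_{H^\alpha}+\|\partial_tu_\varepsilon(t)\|_{L^2}\big)\le c\,\varepsilon^{-N}$ for all $\varepsilon\in(0,1]$.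 Then $u_\varepsilon$ converges to $u$ in $L^2$, uniformly in time: $$\sup_{t\in[0,T]}\|u_\varepsilon(t)-u(t)\|_{L^2(\mathbb R^d)}\longrightarrow 0\qquad\text{as }\varepsilon\to0^+ .$$ -/

import Mathlib

open MeasureTheory Set Filter Topology
open scoped FourierTransform ContDiff ENNReal

namespace FracKleinGordon

noncomputable section

/-- `L²(ℝᵈ)`, complex-valued. -/
abbrev L2 (d : ℕ) : Type := Lp ℂ 2 (volume : Measure (EuclideanSpace ℝ (Fin d)))

/-- The function `ξ ↦ |2πξ|^{2s} û(ξ)`. With the convention `û(ξ) = ∫ u(x) e^{-2πi x·ξ} dx`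
used by Mathlib, `|2πξ|^{2s}` is the symbol of `(-Δ)^s`. -/
def fracSymbolMul {d : ℕ} (s : ℝ) (u : L2 d) : EuclideanSpace ℝ (Fin d) → ℂ :=
  fun ξ => (((2 * Real.pi * ‖ξ‖) ^ (2 * s) : ℝ) : ℂ) * (𝓕 u : L2 d) ξ

/-- `u ∈ L²` and `(-Δ)^s u ∈ L²`. -/
def InFracDomain {d : ℕ} (s : ℝ) (u : L2 d) : Prop :=
  MemLp (fracSymbolMul s u) 2 volume

open Classical in
/-- The fractional Laplacian `(-Δ)^s u ∈ L²` of a function `u` of its domain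
(and `0` outside of the domain). -/
def fracLaplacian {d : ℕ} (s : ℝ) (u : L2 d) : L2 d :=
  if h : InFracDomain s u then 𝓕⁻ (h.toLp (fracSymbolMul s u)) else 0

/-- `u ∈ H^α(ℝᵈ)`, i.e. `u ∈ L²` and `(-Δ)^{α/2} u ∈ L²`. -/
def MemSobolevSpace {d : ℕ} (α : ℝ) (u : L2 d) : Prop := InFracDomain (α / 2) u

/-- `‖u‖_{H^α} = ‖u‖_{L²} + ‖(-Δ)^{α/2} u‖_{L²}`. -/
def sobolevNorm {d : ℕ} (α : ℝ) (u : L2 d) : ℝ := ‖u‖ + ‖fracLaplacian (α / 2) u‖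

/-- `u ∈ C([0,T]; H^α)`. -/
def ContinuousInSobolev {d : ℕ} (α T : ℝ) (u : ℝ → L2 d) : Prop :=
  (∀ t ∈ Icc 0 T, MemSobolevSpace α (u t)) ∧
    ∀ t ∈ Icc 0 T, Tendsto (fun s => sobolevNorm α (u s - u t)) (𝓝[Icc 0 T] t) (𝓝 0)

/-- The time derivative in `L²` on the interval `[0,T]` (one-sided at the end points). -/
def timeDeriv {d : ℕ} (T : ℝ) (u : ℝ → L2 d) (t : ℝ) : L2 d := derivWithin u (Icc 0 T) t

/-- `u ∈ C([0,T]; H^α) ∩ C¹([0,T]; L²)` solves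
`u_tt + (-Δ)^α u + m u = 0` on `(0,T) × ℝᵈ`, `u(0) = u₀`, `u_t(0) = u₁`.
Since `u_tt` and `(-Δ)^α u` take values in the dual of `H^α` only, the equation is
understood after pairing in `L²` with an arbitrary `v ∈ H^α`:
`d/dt ⟨u_t, v⟩ + ⟨(-Δ)^{α/2} u, (-Δ)^{α/2} v⟩ + ⟨m u, v⟩ = 0`, where `⟨f, g⟩ = ∫ f conj(g)`
is `inner ℂ g f` in Mathlib's convention. -/
structure IsSolution {d : ℕ} (α T : ℝ) (m : EuclideanSpace ℝ (Fin d) → ℝ)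
    (u₀ u₁ : L2 d) (u : ℝ → L2 d) : Prop where
  continuous_sobolev : ContinuousInSobolev α T u
  contDiffOn : ContDiffOn ℝ 1 u (Icc 0 T)
  equation : ∀ v : L2 d, MemSobolevSpace α v → ∀ t ∈ Ioo 0 T,
    HasDerivAt (fun s => inner ℂ v (timeDeriv T u s))
      (-(inner ℂ (fracLaplacian (α / 2) v) (fracLaplacian (α / 2) (u t)))
        - ∫ x, (m x : ℂ) * u t x * (starRingEnd ℂ) (v x)) t
  initial_value : u 0 = u₀
  initial_velocity : timeDeriv T u 0 = u₁

/-- `ψ` is a Friedrichs mollifier. -/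
structure IsFriedrichsMollifier {d : ℕ} (ψ : EuclideanSpace ℝ (Fin d) → ℝ) : Prop where
  smooth : ContDiff ℝ ∞ ψ
  compact_support : HasCompactSupport ψ
  nonneg : ∀ x, 0 ≤ ψ x
  integral_eq_one : ∫ x, ψ x = 1

/-- `ψ_ε(x) = ε^{-d} ψ(x/ε)`. -/
def scaled {d : ℕ} (ψ : EuclideanSpace ℝ (Fin d) → ℝ) (ε : ℝ) :
    EuclideanSpace ℝ (Fin d) → ℝ :=
  fun x => (ε ^ d)⁻¹ * ψ (ε⁻¹ • x)

/-- The regularisation `m_ε = m ∗ ψ_ε`. -/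
def regularisation {d : ℕ} (m ψ : EuclideanSpace ℝ (Fin d) → ℝ) (ε : ℝ) :
    EuclideanSpace ℝ (Fin d) → ℝ :=
  convolution m (scaled ψ ε) (ContinuousLinearMap.mul ℝ ℝ) volume

/-- The net `(g_ε)`, `ε ∈ (0,1]`, is `L^∞`-moderate. -/
def IsLinftyModerate {d : ℕ} (g : ℝ → EuclideanSpace ℝ (Fin d) → ℝ) : Prop :=
  (∀ ε ∈ Ioc (0 : ℝ) 1, MemLp (g ε) ∞ volume) ∧
    ∃ N : ℕ, ∃ c : ℝ, 0 < c ∧ ∀ ε ∈ Ioc (0 : ℝ) 1,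
      eLpNorm (g ε) ∞ volume ≤ ENNReal.ofReal (c * (ε ^ N)⁻¹)

/-- The net `(u_ε)`, `ε ∈ (0,1]`, is `C¹`-moderate:
`sup_{t ∈ [0,T]} (‖u_ε(t)‖_{H^α} + ‖∂_t u_ε(t)‖_{L²}) ≤ c ε^{-N}`. -/
def IsC1Moderate {d : ℕ} (α T : ℝ) (u : ℝ → ℝ → L2 d) : Prop :=
  ∃ N : ℕ, ∃ c : ℝ, 0 < c ∧ ∀ ε ∈ Ioc (0 : ℝ) 1, ∀ t ∈ Icc 0 T,
    sobolevNorm α (u ε t) + ‖timeDeriv T (u ε) t‖ ≤ c * (ε ^ N)⁻¹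

/-- `(u_ε)`, `ε ∈ (0,1]`, is the very weak solution given by the regularisation `(m_ε)`
of the mass. -/
structure IsVeryWeakSolution {d : ℕ} (α T : ℝ) (mreg : ℝ → EuclideanSpace ℝ (Fin d) → ℝ)
    (u₀ u₁ : L2 d) (u : ℝ → ℝ → L2 d) : Prop where
  mass_moderate : IsLinftyModerate mreg
  solves : ∀ ε ∈ Ioc (0 : ℝ) 1, IsSolution α T (mreg ε) u₀ u₁ (u ε)
  moderate : IsC1Moderate α T u

end

end FracKleinGordon

/-! The difference `w = u_ε - u` has zero data and solves `w'' + (-Δ)^α w = g` with `g = -m_ε w -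
(m_ε - m) u`. Since `w'` lies only in `L²`, it is no admissible test function; testing with `V(s) =
∫_s^τ w`, which lies in `H^α`, gives `½‖w(τ)‖² ≤ ∫_0^τ Re⟨V, g⟩`
(`half_norm_sq_le_of_weak_wave_equation`). As `|m_ε| ≤ ‖m‖_∞`, Grönwall bounds `‖w‖` uniformly in
time by a quantity vanishing with `∫_0^T ‖(m_ε - m) u‖`, the constants being independent of `ε`
(`IsSolution.norm_sub_le_gronwallBound`). That integral tends to 0 by dominated convergence in `x`,
then in `t`: `m_ε → m` almost everywhere (`IsFriedrichsMollifier.ae_tendsto_regularisation`), and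
uniform convergence of the masses is not required. -/

namespace FracKleinGordon

/-! ### Abstract energy and Grönwall estimates -/

/-- Product rule for the inner product of a function vanishing at `t` and differentiable there
with a function merely continuous at `t`. -/
theorem hasDerivAt_inner_of_eq_zero {E : Type*} [NormedAddCommGroup E] [InnerProductSpace ℂ E]
    [NormedSpace ℝ E] [IsScalarTower ℝ ℂ E] {f g : ℝ → E} {f' : E} {t : ℝ}
    (hf : HasDerivAt f f' t) (hft : f t = 0) (hg : ContinuousAt g t) :
    HasDerivAt (fun s => inner ℂ (f s) (g s)) (inner ℂ f' (g t)) t := by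
  rw [hasDerivAt_iff_tendsto_slope] at hf ⊢
  have h := Tendsto.inner (𝕜 := ℂ) hf (hg.tendsto.mono_left nhdsWithin_le_nhds)
  refine h.congr fun s => ?_
  simp only [slope, vsub_eq_sub, hft, sub_zero, inner_zero_left]
  rw [← algebraMap_smul ℂ (s - t)⁻¹ (f s), inner_smul_left]
  simp

/-- Energy inequality for a weak solution `w` of `w'' + A*A w = g` with zero initial data, where
`B = A w`: the solution is tested with `∫ x in s..τ, w x`. -/
theorem half_norm_sq_le_of_weak_wave_equation {E : Type*} [NormedAddCommGroup E]
    [InnerProductSpace ℂ E] [NormedSpace ℝ E] [IsScalarTower ℝ ℂ E] [CompleteSpace E] {T : ℝ}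
    {w w' B g : ℝ → E} (hw : Continuous w) (hw' : Continuous w') (hB : Continuous B)
    (hg : Continuous g) (hderiv : ∀ t ∈ Ioo 0 T, HasDerivAt w (w' t) t)
    (hw0 : w 0 = 0) (hw'0 : w' 0 = 0)
    (heq : ∀ a b, ∀ t ∈ Ioo 0 T, HasDerivAt (fun s => inner ℂ (∫ x in a..b, w x) (w' s))
      (-inner ℂ (∫ x in a..b, B x) (B t) + inner ℂ (∫ x in a..b, w x) (g t)) t)
    {τ : ℝ} (hτ : τ ∈ Icc 0 T) :
    ‖w τ‖ ^ 2 / 2 ≤ (∫ s in 0..τ, ‖w s‖) * ∫ s in 0..τ, ‖g s‖ := by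
  have hV : ∀ s, HasDerivAt (fun s => ∫ x in s..τ, w x) (-w s) s := fun s =>
    intervalIntegral.integral_hasDerivAt_left (hw.intervalIntegrable _ _)
      (hw.stronglyMeasurableAtFilter _ _) hw.continuousAt
  have hZ : ∀ s, HasDerivAt (fun s => ∫ x in s..τ, B x) (-B s) s := fun s =>
    intervalIntegral.integral_hasDerivAt_left (hB.intervalIntegrable _ _)
      (hB.stronglyMeasurableAtFilter _ _) hB.continuousAt
  set V : ℝ → E := fun s => ∫ x in s..τ, w x with hVdef
  set Z : ℝ → E := fun s => ∫ x in s..τ, B x with hZdef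
  have hVc : Continuous V := continuous_iff_continuousAt.2 fun s => (hV s).continuousAt
  have hZc : Continuous Z := continuous_iff_continuousAt.2 fun s => (hZ s).continuousAt
  -- With `V' = -w` and `Z' = -B`, the two squares cancel `-⟨w, w'⟩` and `-⟨Z, B⟩` in the real part
  -- of `⟨V, w'⟩'`, leaving `Re⟨V, g⟩`.
  let F : ℝ → ℂ := fun s => inner ℂ (V s) (w' s) + (1 / 2) * inner ℂ (w s) (w s)
    - (1 / 2) * inner ℂ (Z s) (Z s)
  have hF : ∀ t ∈ Ioo 0 T, HasDerivAt (fun s => (F s).re) (inner ℂ (V t) (g t)).re t := by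
    intro t ht
    have h1 : HasDerivAt (fun s => inner ℂ (V s) (w' s))
        (-inner ℂ (Z t) (B t) + inner ℂ (V t) (g t) + inner ℂ (-w t) (w' t)) t := by
      -- The weak equation covers the test vector frozen at `V t`; the remainder `V s - V t`
      -- vanishes at `t`, so continuity of `w'` suffices.
      have h := hasDerivAt_inner_of_eq_zero ((hV t).sub_const (V t)) (sub_self _)
        hw'.continuousAt
      refine ((heq t τ t ht).add h).congr_of_eventuallyEq (Eventually.of_forall fun s => ?_)
      simp [hVdef]
    have h2 := ((hderiv t ht).inner ℂ (hderiv t ht)).const_mul (1 / 2 : ℂ)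
    have h3 := ((hZ t).inner ℂ (hZ t)).const_mul (1 / 2 : ℂ)
    have h := Complex.reCLM.hasFDerivAt.comp_hasDerivAt t ((h1.add h2).sub h3)
    refine h.congr_deriv ?_
    have e1 := inner_re_symm (𝕜 := ℂ) (w' t) (w t)
    have e2 := inner_re_symm (𝕜 := ℂ) (Z t) (B t)
    simp only [RCLike.re_to_complex] at e1 e2
    simp [inner_neg_left, inner_neg_right, e1, e2]
    ring
  have hFc : Continuous fun s => (F s).re := by
    refine Complex.continuous_re.comp ?_
    exact ((hVc.inner hw').add (continuous_const.mul (hw.inner hw))).sub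
      (continuous_const.mul (hZc.inner hZc))
  have hint : Continuous fun s => (inner ℂ (V s) (g s)).re :=
    Complex.continuous_re.comp (hVc.inner hg)
  have hFTC := intervalIntegral.integral_eq_sub_of_hasDerivAt_of_le hτ.1 hFc.continuousOn
    (fun t ht => hF t ⟨ht.1, ht.2.trans_le hτ.2⟩) (hint.intervalIntegrable 0 τ)
  have hself : ∀ x : E, (inner ℂ x x).re = ‖x‖ ^ 2 := fun x => by
    rw [inner_self_eq_norm_sq_to_K]; norm_cast
  have hFτ : (F τ).re = ‖w τ‖ ^ 2 / 2 := by
    simp [F, V, Z, hself, -inner_self_eq_norm_sq_to_K]; ring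
  have hF0 : (F 0).re ≤ 0 := by
    have : (F 0).re = -(‖Z 0‖ ^ 2 / 2) := by
      simp [F, hw0, hw'0, hself, -inner_self_eq_norm_sq_to_K]; ring
    rw [this]
    exact neg_nonpos.2 (by positivity)
  have hVle : ∀ s ∈ Icc 0 τ, ‖V s‖ ≤ ∫ s in 0..τ, ‖w s‖ := by
    intro s hs
    refine (intervalIntegral.norm_integral_le_integral_norm hs.2).trans ?_
    exact intervalIntegral.integral_mono_interval hs.1 hs.2 le_rfl
      (Eventually.of_forall fun _ => norm_nonneg _) (hw.norm.intervalIntegrable _ _)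
  calc ‖w τ‖ ^ 2 / 2 ≤ ∫ s in 0..τ, (inner ℂ (V s) (g s)).re := by rw [hFTC, hFτ]; linarith
    _ ≤ ∫ s in 0..τ, (∫ s in 0..τ, ‖w s‖) * ‖g s‖ := by
        refine intervalIntegral.integral_mono_on hτ.1 (hint.intervalIntegrable _ _)
          ((continuous_const.mul hg.norm).intervalIntegrable _ _) fun s hs => ?_
        refine (Complex.re_le_norm _).trans ((norm_inner_le_norm _ _).trans ?_)
        exact mul_le_mul_of_nonneg_right (hVle s hs) (norm_nonneg _)
    _ = _ := intervalIntegral.integral_const_mul _ _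

/-- A quadratic Grönwall inequality. -/
theorem le_gronwallBound_of_half_sq_le {φ : ℝ → ℝ} (hφ : Continuous φ) (hφ0 : ∀ s, 0 ≤ φ s)
    {M C T : ℝ} (hM : 0 ≤ M) (hC : 0 ≤ C)
    (h : ∀ τ ∈ Icc 0 T, φ τ ^ 2 / 2 ≤
      (∫ s in 0..τ, φ s) * (M * (∫ s in 0..τ, φ s) + C)) :
    ∀ τ ∈ Icc 0 T, φ τ ≤ √(2 * M + 1) * gronwallBound 0 √(2 * M + 1) C T + C := by
  -- The extra `1` absorbs the cross term, `2JC ≤ J² + C²`, so that `φ ≤ K J + C`: a linear Grönwall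
  -- inequality for `J`, since `J' = φ`.
  set K := √(2 * M + 1) with hK
  have hK0 : 0 ≤ K := Real.sqrt_nonneg _
  have hK2 : K ^ 2 = 2 * M + 1 := Real.sq_sqrt (by positivity)
  set J : ℝ → ℝ := fun τ => ∫ s in 0..τ, φ s with hJ
  have hJ0 : ∀ τ, 0 ≤ τ → 0 ≤ J τ := fun τ hτ =>
    intervalIntegral.integral_nonneg hτ fun s _ => hφ0 s
  have hJd : ∀ s, HasDerivAt J (φ s) s := fun s =>
    intervalIntegral.integral_hasDerivAt_right (hφ.intervalIntegrable _ _)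
      (hφ.stronglyMeasurableAtFilter _ _) hφ.continuousAt
  have hlin : ∀ τ ∈ Icc 0 T, φ τ ≤ K * J τ + C := by
    intro τ hτ
    have hJτ := hJ0 τ hτ.1
    refine abs_le_of_sq_le_sq' ?_ (by positivity) |>.2
    have h1 : φ τ ^ 2 / 2 ≤ J τ * (M * J τ + C) := h τ hτ
    have h2 : 0 ≤ K * J τ * C := by positivity
    have h3 : (K * J τ + C) ^ 2 = (2 * M + 1) * J τ ^ 2 + 2 * (K * J τ * C) + C ^ 2 := by
      rw [← hK2]; ring
    nlinarith [sq_nonneg (J τ - C)]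
  intro τ hτ
  have hG := norm_le_gronwallBound_of_norm_deriv_right_le (f := J) (f' := φ) (δ := 0) (K := K)
    (ε := C) (a := 0) (b := T)
    (fun s _ => (hJd s).continuousAt.continuousWithinAt)
    (fun s _ => (hJd s).hasDerivWithinAt) (by simp [hJ])
    (fun s hs => by
      rw [Real.norm_of_nonneg (hφ0 s), Real.norm_of_nonneg (hJ0 s hs.1)]
      exact hlin s ⟨hs.1, hs.2.le⟩) τ hτ
  rw [sub_zero] at hG
  have hG' := (le_abs_self _).trans (hG.trans (gronwallBound_mono le_rfl hC hK0 hτ.2))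
  exact (hlin τ hτ).trans (by gcongr)

/-! ### Multiplication operators on `L²` -/

/-- Multiplication by a real function of `L^∞`, as an operator on `L²`. -/
noncomputable def mulOp {d : ℕ} (φ : EuclideanSpace ℝ (Fin d) → ℝ) (hφ : MemLp φ ∞ volume) :
    L2 d →L[ℂ] L2 d :=
  (ContinuousLinearMap.mul ℂ ℂ).holderL volume ∞ 2 2 (hφ.ofReal (K := ℂ)).toLp

theorem coeFn_mulOp {d : ℕ} {φ : EuclideanSpace ℝ (Fin d) → ℝ} (hφ : MemLp φ ∞ volume)
    (f : L2 d) : mulOp φ hφ f =ᵐ[volume] fun x => (φ x : ℂ) * f x := by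
  have h := (ContinuousLinearMap.mul ℂ ℂ).coeFn_holder (r := 2)
    (hφ.ofReal (K := ℂ)).toLp f
  filter_upwards [h, (hφ.ofReal (K := ℂ)).coeFn_toLp] with x h1 h2
  rw [mulOp, ContinuousLinearMap.holderL_apply_apply, h1, h2]
  rfl

theorem norm_mulOp_le {d : ℕ} {φ : EuclideanSpace ℝ (Fin d) → ℝ} (hφ : MemLp φ ∞ volume)
    {M : ℝ} (hM : ∀ᵐ x, |φ x| ≤ M) (f : L2 d) : ‖mulOp φ hφ f‖ ≤ M * ‖f‖ := by
  refine Lp.norm_le_mul_norm_of_ae_le_mul ?_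
  filter_upwards [coeFn_mulOp hφ f, hM] with x h1 h2
  rw [h1, norm_mul, Complex.norm_real, Real.norm_eq_abs]
  gcongr

theorem integral_mul_mul_conj_eq_inner {d : ℕ} {φ : EuclideanSpace ℝ (Fin d) → ℝ}
    (hφ : MemLp φ ∞ volume) (f v : L2 d) :
    ∫ x, (φ x : ℂ) * f x * (starRingEnd ℂ) (v x) = inner ℂ v (mulOp φ hφ f) := by
  rw [L2.inner_def]
  refine integral_congr_ae ?_
  filter_upwards [coeFn_mulOp hφ f] with x hx
  rw [hx, RCLike.inner_apply]

/-- Multiplication by uniformly bounded functions converging almost everywhere converges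
strongly on `L²`. -/
theorem tendsto_norm_mulOp_sub {d : ℕ} {ι : Type*} {l : Filter ι} [l.IsCountablyGenerated]
    {φ : EuclideanSpace ℝ (Fin d) → ℝ} (hφ : MemLp φ ∞ volume)
    {ψ : ι → EuclideanSpace ℝ (Fin d) → ℝ} (G : ι → L2 d →L[ℂ] L2 d)
    (hG : ∀ᶠ i in l, ∃ h : MemLp (ψ i) ∞ volume, G i = mulOp (ψ i) h)
    {M : ℝ} (hM : ∀ᵐ x, |φ x| ≤ M) (hψM : ∀ᶠ i in l, ∀ᵐ x, |ψ i x| ≤ M)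
    (hlim : ∀ᵐ x, Tendsto (fun i => ψ i x) l (𝓝 (φ x))) (f : L2 d) :
    Tendsto (fun i => ‖G i f - mulOp φ hφ f‖) l (𝓝 0) := by
  have hsq : ∀ g : L2 d, ‖g‖ ^ 2 = ∫ x, ‖g x‖ ^ 2 := fun g => by
    have h1 : ((‖g‖ ^ 2 : ℝ) : ℂ) = ((∫ x, ‖g x‖ ^ 2 : ℝ) : ℂ) := by
      rw [← integral_complex_ofReal]
      have h2 := inner_self_eq_norm_sq_to_K (𝕜 := ℂ) g
      rw [L2.inner_def] at h2
      push_cast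
      refine Eq.trans h2.symm (integral_congr_ae (Eventually.of_forall fun x => ?_))
      exact inner_self_eq_norm_sq_to_K (𝕜 := ℂ) (g x)
    exact_mod_cast h1
  have hint : Tendsto (fun i => ∫ x, ‖(ψ i x : ℂ) * f x - (φ x : ℂ) * f x‖ ^ 2) l
      (𝓝 (∫ _ : EuclideanSpace ℝ (Fin d), (0 : ℝ))) := by
    refine tendsto_integral_filter_of_dominated_convergence
      (fun x => (2 * M) ^ 2 * ‖f x‖ ^ 2) ?_ ?_ ?_ ?_
    · filter_upwards [hG] with i hi
      obtain ⟨h, -⟩ := hi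
      have hf := (Lp.memLp f).1
      exact (((((h.ofReal (K := ℂ)).1.mul hf).sub
        ((hφ.ofReal (K := ℂ)).1.mul hf)).norm).pow 2)
    · filter_upwards [hψM] with i hi
      filter_upwards [hi, hM] with x h1 h2
      rw [Real.norm_of_nonneg (by positivity), ← mul_pow, ← sub_mul, norm_mul]
      gcongr
      refine (norm_sub_le _ _).trans ?_
      rw [Complex.norm_real, Complex.norm_real, Real.norm_eq_abs, Real.norm_eq_abs]
      linarith
    · exact ((memLp_two_iff_integrable_sq_norm (Lp.memLp f).1).1 (Lp.memLp f)).const_mul _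
    · filter_upwards [hlim] with x hx
      have h1 : Tendsto (fun i => (ψ i x : ℂ)) l (𝓝 (φ x : ℂ)) :=
        (Complex.continuous_ofReal.tendsto _).comp hx
      have h2 := (((h1.mul_const (f x)).sub_const ((φ x : ℂ) * f x)).norm).pow 2
      simpa using h2
  have h := (hint.congr' (f₂ := fun i => ‖G i f - mulOp φ hφ f‖ ^ 2) ?_).sqrt
  · simpa using h
  · filter_upwards [hG] with i hi
    obtain ⟨h, hi⟩ := hi
    rw [hsq, hi]
    refine integral_congr_ae ?_
    filter_upwards [Lp.coeFn_sub (mulOp (ψ i) h f) (mulOp φ hφ f), coeFn_mulOp h f,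
      coeFn_mulOp hφ f] with x h1 h2 h3
    rw [h1, Pi.sub_apply, h2, h3]

/-! ### The fractional Laplacian as a closed operator -/

section FracLaplacian

variable {d : ℕ} (s : ℝ)

/-- Dividing `σ û = ẑ` by `1 + σ` makes both multipliers bounded, so the graph of the unbounded
operator is described by bounded operators. -/
theorem memLp_symbol_div : MemLp (fun ξ : EuclideanSpace ℝ (Fin d) =>
    (2 * Real.pi * ‖ξ‖) ^ (2 * s) / (1 + (2 * Real.pi * ‖ξ‖) ^ (2 * s))) ∞ volume := by
  refine memLp_top_of_bound (Measurable.aestronglyMeasurable (by fun_prop)) 1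
    (Eventually.of_forall fun ξ => ?_)
  have h : 0 ≤ (2 * Real.pi * ‖ξ‖) ^ (2 * s) := by positivity
  rw [Real.norm_of_nonneg (by positivity)]
  exact div_le_one_of_le₀ (by linarith) (by linarith)

theorem memLp_one_div_symbol : MemLp (fun ξ : EuclideanSpace ℝ (Fin d) =>
    1 / (1 + (2 * Real.pi * ‖ξ‖) ^ (2 * s))) ∞ volume := by
  refine memLp_top_of_bound (Measurable.aestronglyMeasurable (by fun_prop)) 1
    (Eventually.of_forall fun ξ => ?_)
  have h : 0 ≤ (2 * Real.pi * ‖ξ‖) ^ (2 * s) := by positivity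
  rw [Real.norm_of_nonneg (by positivity)]
  exact div_le_one_of_le₀ (by linarith) (by linarith)

/-- `σ / (1 + σ)` applied on the Fourier side, `σ` being the symbol of `(-Δ)^s`. -/
noncomputable def symbolDivOp : L2 d →L[ℂ] L2 d :=
  (mulOp _ (memLp_symbol_div s)).comp (FourierTransform.fourierCLM ℂ (L2 d))

/-- `1 / (1 + σ)` applied on the Fourier side, `σ` being the symbol of `(-Δ)^s`. -/
noncomputable def oneDivOp : L2 d →L[ℂ] L2 d :=
  (mulOp _ (memLp_one_div_symbol s)).comp (FourierTransform.fourierCLM ℂ (L2 d))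

/-- The graph of `(-Δ)^s` as the equalizer of two bounded operators. -/
theorem fracLaplacian_eq_iff (u z : L2 d) :
    (InFracDomain s u ∧ fracLaplacian s u = z) ↔ symbolDivOp s u = oneDivOp s z := by
  have hiff : symbolDivOp s u = oneDivOp s z ↔ (𝓕 z : L2 d) =ᵐ[volume] fracSymbolMul s u := by
    rw [Lp.ext_iff]
    have h1 : symbolDivOp s u =ᵐ[volume] _ := coeFn_mulOp (memLp_symbol_div s) (𝓕 u : L2 d)
    have h2 : oneDivOp s z =ᵐ[volume] _ := coeFn_mulOp (memLp_one_div_symbol s) (𝓕 z : L2 d)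
    refine Filter.eventually_congr ?_
    filter_upwards [h1, h2] with ξ h1 h2
    rw [h1, h2, fracSymbolMul]
    have h : 0 ≤ (2 * Real.pi * ‖ξ‖) ^ (2 * s) := by positivity
    generalize (2 * Real.pi * ‖ξ‖) ^ (2 * s) = σ at h
    have h0 : (1 + (σ : ℂ)) ≠ 0 := by
      norm_cast
      linarith
    push_cast
    rw [div_mul_eq_mul_div, div_mul_eq_mul_div, div_left_inj' h0, one_mul, eq_comm]
  rw [hiff]
  constructor
  · rintro ⟨h, rfl⟩
    rw [fracLaplacian, dif_pos h, FourierTransform.fourier_fourierInv_eq]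
    exact h.coeFn_toLp
  · intro h
    have hdom : InFracDomain s u := (memLp_congr_ae h).1 (Lp.memLp _)
    refine ⟨hdom, ?_⟩
    rw [fracLaplacian, dif_pos hdom]
    have : hdom.toLp = (𝓕 z : L2 d) := Lp.ext (hdom.coeFn_toLp.trans h.symm)
    rw [this, FourierTransform.fourierInv_fourier_eq]

variable {s}

theorem fracLaplacian_sub {u v : L2 d} (hu : InFracDomain s u) (hv : InFracDomain s v) :
    InFracDomain s (u - v) ∧ fracLaplacian s (u - v) = fracLaplacian s u - fracLaplacian s v := by
  rw [fracLaplacian_eq_iff, map_sub, map_sub, (fracLaplacian_eq_iff s _ _).1 ⟨hu, rfl⟩,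
    (fracLaplacian_eq_iff s _ _).1 ⟨hv, rfl⟩]

/-- Bounded operators pass under the integral, hence so does the graph relation. This makes time
integrals of `w` admissible test functions. -/
theorem fracLaplacian_integral {w B : ℝ → L2 d} (hw : Continuous w) (hB : Continuous B)
    (h : ∀ t, InFracDomain s (w t) ∧ fracLaplacian s (w t) = B t) (a b : ℝ) :
    InFracDomain s (∫ x in a..b, w x) ∧
      fracLaplacian s (∫ x in a..b, w x) = ∫ x in a..b, B x := by
  rw [fracLaplacian_eq_iff, ← (symbolDivOp s).intervalIntegral_comp_comm (hw.intervalIntegrable _ _),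
    ← (oneDivOp s).intervalIntegral_comp_comm (hB.intervalIntegrable _ _)]
  exact intervalIntegral.integral_congr fun t _ => (fracLaplacian_eq_iff s _ _).1 (h t)

end FracLaplacian

/-! ### Convergence of the regularised masses -/

section Mollifier

variable {d : ℕ} {ψ : EuclideanSpace ℝ (Fin d) → ℝ}

theorem IsFriedrichsMollifier.scaled_nonneg (hψ : IsFriedrichsMollifier ψ) {ε : ℝ} (hε : 0 < ε)
    (x : EuclideanSpace ℝ (Fin d)) : 0 ≤ scaled ψ ε x :=
  mul_nonneg (by positivity) (hψ.nonneg _)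

theorem IsFriedrichsMollifier.integral_scaled_sub (hψ : IsFriedrichsMollifier ψ) {ε : ℝ}
    (hε : 0 < ε) (x : EuclideanSpace ℝ (Fin d)) : ∫ y, scaled ψ ε (x - y) = 1 := by
  rw [integral_sub_left_eq_self (scaled ψ ε) volume x]
  simp only [scaled]
  rw [integral_const_mul, Measure.integral_comp_inv_smul, hψ.integral_eq_one]
  simp [abs_of_pos (pow_pos hε d), hε.ne']

theorem IsFriedrichsMollifier.abs_regularisation_le (hψ : IsFriedrichsMollifier ψ)
    {m : EuclideanSpace ℝ (Fin d) → ℝ} {M : ℝ} (hM : ∀ᵐ x, |m x| ≤ M) {ε : ℝ} (hε : 0 < ε)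
    (x : EuclideanSpace ℝ (Fin d)) : |regularisation m ψ ε x| ≤ M := by
  have hi : Integrable fun y => scaled ψ ε (x - y) := by
    -- A non-integrable function would have integral 0 by convention, not 1.
    by_contra h
    simpa [integral_undef h] using hψ.integral_scaled_sub hε x
  rw [regularisation, convolution_def, ← Real.norm_eq_abs]
  calc ‖∫ y, (ContinuousLinearMap.mul ℝ ℝ) (m y) (scaled ψ ε (x - y))‖
      ≤ ∫ y, M * scaled ψ ε (x - y) := by
        refine norm_integral_le_of_norm_le (hi.const_mul M) ?_
        filter_upwards [hM] with y hy
        rw [ContinuousLinearMap.mul_apply', norm_mul, Real.norm_eq_abs,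
          Real.norm_of_nonneg (hψ.scaled_nonneg hε _)]
        exact mul_le_mul_of_nonneg_right hy (hψ.scaled_nonneg hε _)
    _ = M := by rw [integral_const_mul, hψ.integral_scaled_sub hε, mul_one]

/-- At almost every point, the regularisations of a locally integrable function converge to it. -/
theorem IsFriedrichsMollifier.ae_tendsto_regularisation (hψ : IsFriedrichsMollifier ψ)
    {m : EuclideanSpace ℝ (Fin d) → ℝ} (hm : LocallyIntegrable m volume) :
    ∀ᵐ x, Tendsto (fun ε => regularisation m ψ ε x) (𝓝[>] 0) (𝓝 (m x)) := by
  obtain ⟨R, hR0, hR⟩ := hψ.compact_support.isCompact.isBounded.exists_pos_norm_le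
  obtain ⟨C, hC⟩ := hψ.smooth.continuous.bounded_above_of_compact_support hψ.compact_support
  filter_upwards [(Besicovitch.vitaliFamily volume).ae_tendsto_average_norm_sub hm] with x hx
  have hrad : Tendsto (fun ε : ℝ => R * ε) (𝓝[>] 0) (𝓝[>] 0) := by
    refine tendsto_nhdsWithin_iff.2 ⟨?_, ?_⟩
    · have : Tendsto (fun ε : ℝ => R * ε) (𝓝 0) (𝓝 (R * 0)) :=
        tendsto_id.const_mul R
      simpa using this.mono_left nhdsWithin_le_nhds
    · filter_upwards [self_mem_nhdsWithin] with ε hε using mul_pos hR0 hε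
  have hav := (hx.comp (Besicovitch.tendsto_filterAt volume x)).comp hrad
  -- Chosen so that `K` over the volume of the ball of radius `R * ε` is `C ε^{-d}`, a bound for the
  -- kernel, which is supported in that ball; convergence then holds at Lebesgue points.
  set K : ℝ := C * R ^ d * volume.real (Metric.closedBall (0 : EuclideanSpace ℝ (Fin d)) 1)
  have h := tendsto_integral_smul_of_tendsto_average_norm_sub
    (g := fun ε y => scaled ψ ε (x - y)) K hav
    (Eventually.of_forall fun ε => hm.integrableOn_isCompact (isCompact_closedBall _ _))
    (tendsto_const_nhds.congr' ?_) ?_ ?_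
  · refine h.congr fun ε => ?_
    rw [regularisation, convolution_def]
    simp [mul_comm]
  · filter_upwards [self_mem_nhdsWithin] with ε hε using (hψ.integral_scaled_sub hε x).symm
  · filter_upwards [self_mem_nhdsWithin] with ε hε y hy
    have hε : 0 < ε := hε
    have h1 : ψ (ε⁻¹ • (x - y)) ≠ 0 := right_ne_zero_of_mul hy
    have h2 := hR _ (subset_tsupport _ h1)
    rw [norm_smul, norm_inv, Real.norm_of_nonneg hε.le, inv_mul_le_iff₀ hε] at h2
    rw [Metric.mem_closedBall, dist_eq_norm, norm_sub_rev, mul_comm]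
    exact h2
  · filter_upwards [self_mem_nhdsWithin] with ε hε y
    have hε : 0 < ε := hε
    have hv : volume.real (Metric.closedBall (0 : EuclideanSpace ℝ (Fin d)) 1) ≠ 0 :=
      ENNReal.toReal_ne_zero.2 ⟨(Metric.measure_closedBall_pos _ _ one_pos).ne',
        measure_closedBall_lt_top.ne⟩
    rw [Measure.addHaar_real_closedBall' _ _ (by positivity), scaled, abs_mul,
      finrank_euclideanSpace_fin, abs_of_nonneg (by positivity), mul_pow]
    have hCψ : |ψ (ε⁻¹ • (x - y))| ≤ C := hC _
    have hK : K / (R ^ d * ε ^ d *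
        volume.real (Metric.closedBall (0 : EuclideanSpace ℝ (Fin d)) 1)) = (ε ^ d)⁻¹ * C := by
      simp only [K]
      field_simp
    rw [hK]
    gcongr

end Mollifier

/-! ### Stability of solutions in the mass -/

section Solution

variable {d : ℕ} {α T : ℝ} {u v : ℝ → L2 d} {u₀ u₁ : L2 d} {m n : EuclideanSpace ℝ (Fin d) → ℝ}

theorem ContinuousInSobolev.continuousOn_fracLaplacian (hu : ContinuousInSobolev α T u) :
    ContinuousOn (fun t => fracLaplacian (α / 2) (u t)) (Icc 0 T) := by
  intro t ht
  refine tendsto_iff_norm_sub_tendsto_zero.2 ?_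
  refine squeeze_zero' (Eventually.of_forall fun _ => norm_nonneg _) ?_ (hu.2 t ht)
  filter_upwards [self_mem_nhdsWithin] with s hs
  rw [← (fracLaplacian_sub (hu.1 s hs) (hu.1 t ht)).2, sobolevNorm]
  exact le_add_of_nonneg_left (norm_nonneg _)

theorem IsSolution.hasDerivAt_inner_timeDeriv (hu : IsSolution α T m u₀ u₁ u)
    (hm : MemLp m ∞ volume) {f : L2 d} (hf : MemSobolevSpace α f) {t : ℝ} (ht : t ∈ Ioo 0 T) :
    HasDerivAt (fun s => inner ℂ f (timeDeriv T u s))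
      (-inner ℂ (fracLaplacian (α / 2) f) (fracLaplacian (α / 2) (u t))
        - inner ℂ f (mulOp m hm (u t))) t := by
  rw [← integral_mul_mul_conj_eq_inner]
  exact hu.equation f hf t ht

theorem IsSolution.hasDerivAt (hu : IsSolution α T m u₀ u₁ u) {t : ℝ} (ht : t ∈ Ioo 0 T) :
    HasDerivAt u (timeDeriv T u t) t :=
  (hu.contDiffOn.differentiableOn one_ne_zero t
    (Ioo_subset_Icc_self ht)).hasDerivWithinAt.hasDerivAt (Icc_mem_nhds ht.1 ht.2)

theorem IsSolution.continuousOn_timeDeriv (hu : IsSolution α T m u₀ u₁ u) (hT : 0 < T) :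
    ContinuousOn (timeDeriv T u) (Icc 0 T) :=
  hu.contDiffOn.continuousOn_derivWithin (uniqueDiffOn_Icc hT) le_rfl

/-- Continuous dependence of the solution on the mass, in `L²`. -/
theorem IsSolution.norm_sub_le_gronwallBound (hT : 0 < T) (hu : IsSolution α T m u₀ u₁ u)
    (hv : IsSolution α T n u₀ u₁ v) (hm : MemLp m ∞ volume) (hn : MemLp n ∞ volume) {M C : ℝ}
    (hM0 : 0 ≤ M) (hM : ∀ᵐ x, |n x| ≤ M)
    (hC : C = ∫ s in 0..T, ‖mulOp n hn (u (projIcc 0 T hT.le s))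
      - mulOp m hm (u (projIcc 0 T hT.le s))‖) {τ : ℝ} (hτ : τ ∈ Icc 0 T) :
    ‖v τ - u τ‖ ≤ √(2 * M + 1) * gronwallBound 0 √(2 * M + 1) C T + C := by
  -- Clamping time to `[0, T]` yields functions continuous on all of `ℝ`, unchanged on the interval.
  let c : ℝ → ℝ := fun s => projIcc 0 T hT.le s
  have hc : ∀ s ∈ Icc 0 T, c s = s := fun s hs => by simp [c, projIcc_of_mem hT.le hs]
  have hcm : ∀ s, c s ∈ Icc 0 T := fun s => (projIcc 0 T hT.le s).2
  have hcc : Continuous c := continuous_subtype_val.comp continuous_projIcc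
  have hcomp : ∀ {f : ℝ → L2 d}, ContinuousOn f (Icc 0 T) → Continuous fun s => f (c s) :=
    fun hf => hf.comp_continuous hcc hcm
  have hce : ∀ t ∈ Ioo 0 T, c =ᶠ[𝓝 t] id := fun t ht => by
    filter_upwards [Icc_mem_nhds ht.1 ht.2] with s hs using hc s hs
  have huc : Continuous fun s => u (c s) := hcomp hu.contDiffOn.continuousOn
  have hvc : Continuous fun s => v (c s) := hcomp hv.contDiffOn.continuousOn
  let w : ℝ → L2 d := fun s => v (c s) - u (c s)
  let w' : ℝ → L2 d := fun s => timeDeriv T v (c s) - timeDeriv T u (c s)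
  let B : ℝ → L2 d := fun s => fracLaplacian (α / 2) (v (c s)) - fracLaplacian (α / 2) (u (c s))
  let g : ℝ → L2 d := fun s => mulOp m hm (u (c s)) - mulOp n hn (v (c s))
  have hw : Continuous w := hvc.sub huc
  have hw' : Continuous w' :=
    (hcomp (hv.continuousOn_timeDeriv hT)).sub (hcomp (hu.continuousOn_timeDeriv hT))
  have hB : Continuous B := (hcomp hv.continuous_sobolev.continuousOn_fracLaplacian).sub
    (hcomp hu.continuous_sobolev.continuousOn_fracLaplacian)
  have hg : Continuous g := ((mulOp m hm).continuous.comp huc).sub ((mulOp n hn).continuous.comp hvc)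
  have hwB : ∀ t, InFracDomain (α / 2) (w t) ∧ fracLaplacian (α / 2) (w t) = B t := fun t =>
    fracLaplacian_sub (hv.continuous_sobolev.1 _ (hcm t)) (hu.continuous_sobolev.1 _ (hcm t))
  have hc0 : c 0 = 0 := hc 0 ⟨le_rfl, hT.le⟩
  have henergy : ∀ τ ∈ Icc 0 T,
      ‖w τ‖ ^ 2 / 2 ≤ (∫ s in 0..τ, ‖w s‖) * ∫ s in 0..τ, ‖g s‖ := by
    intro τ hτ
    refine half_norm_sq_le_of_weak_wave_equation hw hw' hB hg ?_ ?_ ?_ ?_ hτ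
    · intro t ht
      have h := (hv.hasDerivAt ht).sub (hu.hasDerivAt ht)
      simp only [w', hc t (Ioo_subset_Icc_self ht)]
      refine h.congr_of_eventuallyEq ?_
      filter_upwards [hce t ht] with s hs
      simp [w, hs]
    · simp [w, hc0, hu.initial_value, hv.initial_value]
    · simp [w', hc0, hu.initial_velocity, hv.initial_velocity]
    · intro a b t ht
      obtain ⟨hdom, hfrac⟩ := fracLaplacian_integral hw hB hwB a b
      have h := (hv.hasDerivAt_inner_timeDeriv hn hdom ht).sub
        (hu.hasDerivAt_inner_timeDeriv hm hdom ht)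
      rw [hfrac] at h
      refine (h.congr_of_eventuallyEq ?_).congr_deriv ?_
      · filter_upwards [hce t ht] with s hs
        simp [w', hs]
      · simp only [B, g, hc t (Ioo_subset_Icc_self ht), inner_sub_right]
        ring
  let η : ℝ → ℝ := fun s => ‖mulOp n hn (u (c s)) - mulOp m hm (u (c s))‖
  have hη : Continuous η :=
    (((mulOp n hn).continuous.comp huc).sub ((mulOp m hm).continuous.comp huc)).norm
  have hgle : ∀ s, ‖g s‖ ≤ M * ‖w s‖ + η s := by
    intro s
    -- The mass difference is made to act on `u` rather than `v`, so the error involves only the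
    -- fixed classical solution.
    have : g s = -mulOp n hn (w s) - (mulOp n hn (u (c s)) - mulOp m hm (u (c s))) := by
      simp only [g, w, map_sub]
      abel
    rw [this]
    refine (norm_sub_le _ _).trans ?_
    rw [norm_neg]
    exact add_le_add_left (norm_mulOp_le hn hM _) _
  have hC0 : 0 ≤ C := by
    rw [hC]
    exact intervalIntegral.integral_nonneg hT.le fun _ _ => norm_nonneg _
  have h := le_gronwallBound_of_half_sq_le hw.norm (fun s => norm_nonneg (w s)) hM0 hC0
    (fun τ hτ => (henergy τ hτ).trans ?_) τ hτ
  · simpa [w, hc τ hτ] using h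
  refine mul_le_mul_of_nonneg_left ?_
    (intervalIntegral.integral_nonneg hτ.1 fun _ _ => norm_nonneg _)
  calc ∫ s in 0..τ, ‖g s‖ ≤ ∫ s in 0..τ, (M * ‖w s‖ + η s) :=
        intervalIntegral.integral_mono_on hτ.1 (hg.norm.intervalIntegrable _ _)
          (((hw.norm.const_mul M).add hη).intervalIntegrable _ _) fun s _ => hgle s
    _ = M * (∫ s in 0..τ, ‖w s‖) + ∫ s in 0..τ, η s := by
        rw [intervalIntegral.integral_add ((hw.norm.const_mul M).intervalIntegrable _ _)
          (hη.intervalIntegrable _ _), intervalIntegral.integral_const_mul]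
    _ ≤ _ := by
        gcongr
        rw [hC]
        exact intervalIntegral.integral_mono_interval le_rfl hτ.1 hτ.2
          (Eventually.of_forall fun _ => norm_nonneg _) (hη.intervalIntegrable _ _)

end Solution

end FracKleinGordon

/-! ### Passage to the limit -/

theorem mainTheorem4 (d : ℕ) (hd : 0 < d) (α T : ℝ) (hα : 0 < α) (hT : 0 < T)
    (m : EuclideanSpace ℝ (Fin d) → ℝ)
    (hm : MeasureTheory.MemLp m ⊤ MeasureTheory.volume)
    (hm0 : ∀ᵐ x ∂(MeasureTheory.volume : MeasureTheory.Measure (EuclideanSpace ℝ (Fin d))),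
      0 ≤ m x)
    (u₀ u₁ : FracKleinGordon.L2 d) (hu₀ : FracKleinGordon.MemSobolevSpace α u₀)
    (u : ℝ → FracKleinGordon.L2 d) (hu : FracKleinGordon.IsSolution α T m u₀ u₁ u)
    (ψ : EuclideanSpace ℝ (Fin d) → ℝ) (hψ : FracKleinGordon.IsFriedrichsMollifier ψ)
    (uε : ℝ → ℝ → FracKleinGordon.L2 d)
    (huε : FracKleinGordon.IsVeryWeakSolution α T
      (FracKleinGordon.regularisation m ψ) u₀ u₁ uε) :
    TendstoUniformlyOn uε u (𝓝[>] (0 : ℝ)) (Set.Icc 0 T) := by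
  classical
  obtain ⟨M, hM0, hM⟩ : ∃ M : ℝ, 0 ≤ M ∧ ∀ᵐ x, |m x| ≤ M := by
    refine ⟨(eLpNorm m ⊤ volume).toReal, ENNReal.toReal_nonneg, ?_⟩
    rw [eLpNorm_exponent_top]
    filter_upwards [ae_le_eLpNormEssSup (f := m) (μ := volume)] with x hx
    have hfin := hm.2.ne
    rw [eLpNorm_exponent_top] at hfin
    simpa using ENNReal.toReal_mono hfin hx
  have hIoc : ∀ᶠ ε : ℝ in 𝓝[>] 0, ε ∈ Ioc (0 : ℝ) 1 := Ioc_mem_nhdsGT one_pos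
  have hmε := huε.mass_moderate.1
  -- Averaging preserves the bound `M`, which keeps the Grönwall constant independent of `ε`.
  have hMε : ∀ ε ∈ Ioc (0 : ℝ) 1, ∀ᵐ x, |FracKleinGordon.regularisation m ψ ε x| ≤ M :=
    fun ε hε => Eventually.of_forall (hψ.abs_regularisation_le hM hε.1)
  -- The value 0 outside `(0, 1]` is harmless: the limit `ε → 0⁺` sees only `(0, 1]`.
  let G : ℝ → FracKleinGordon.L2 d →L[ℂ] FracKleinGordon.L2 d := fun ε =>
    if h : ε ∈ Ioc (0 : ℝ) 1 then FracKleinGordon.mulOp _ (hmε ε h) else 0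
  have hG : ∀ ε (h : ε ∈ Ioc (0 : ℝ) 1), G ε = FracKleinGordon.mulOp _ (hmε ε h) :=
    fun ε h => dif_pos h
  have hlim : ∀ f, Tendsto (fun ε => ‖G ε f - FracKleinGordon.mulOp m hm f‖) (𝓝[>] 0) (𝓝 0) :=
    FracKleinGordon.tendsto_norm_mulOp_sub hm G
      (hIoc.mono fun ε h => ⟨hmε ε h, hG ε h⟩) hM (hIoc.mono hMε)
      (hψ.ae_tendsto_regularisation (hm.locallyIntegrable le_top))
  have huc : Continuous fun s => u (projIcc 0 T hT.le s) :=
    hu.contDiffOn.continuousOn.comp_continuous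
      (continuous_subtype_val.comp continuous_projIcc) fun s => (projIcc 0 T hT.le s).2
  let C : ℝ → ℝ := fun ε => ∫ s in 0..T,
    ‖G ε (u (projIcc 0 T hT.le s)) - FracKleinGordon.mulOp m hm (u (projIcc 0 T hT.le s))‖
  have hC : Tendsto C (𝓝[>] 0) (𝓝 0) := by
    have h : Tendsto C (𝓝[>] 0) (𝓝 (∫ _ in 0..T, (0 : ℝ))) := by
      refine intervalIntegral.tendsto_integral_filter_of_dominated_convergence
        (fun s => 2 * M * ‖u (projIcc 0 T hT.le s)‖) ?_ ?_ ?_ ?_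
      · refine Eventually.of_forall fun ε => Continuous.aestronglyMeasurable ?_
        exact (((G ε).continuous.comp huc).sub
          ((FracKleinGordon.mulOp m hm).continuous.comp huc)).norm
      · filter_upwards [hIoc] with ε hε
        refine Eventually.of_forall fun s _ => ?_
        rw [norm_norm, hG ε hε]
        refine (norm_sub_le _ _).trans ?_
        have h1 := FracKleinGordon.norm_mulOp_le (hmε ε hε) (hMε ε hε)
          (u (projIcc 0 T hT.le s))
        have h2 := FracKleinGordon.norm_mulOp_le hm hM (u (projIcc 0 T hT.le s))
        linarith
      · exact (huc.norm.const_mul _).intervalIntegrable _ _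
      · exact Eventually.of_forall fun s _ => hlim _
    simpa using h
  have hbound : Tendsto (fun ε => √(2 * M + 1) * gronwallBound 0 √(2 * M + 1) (C ε) T + C ε)
      (𝓝[>] 0) (𝓝 0) := by
    -- With zero initial value, the Grönwall bound is continuous in its forcing term and vanishes
    -- with it.
    have h := (((gronwallBound_continuous_ε 0 √(2 * M + 1) T).tendsto 0).comp hC).const_mul
      √(2 * M + 1) |>.add hC
    simpa [gronwallBound_ε0_δ0] using h
  rw [Metric.tendstoUniformlyOn_iff]
  intro δ hδ
  filter_upwards [hIoc, hbound.eventually_lt_const hδ] with ε hε hlt τ hτ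
  rw [dist_comm, dist_eq_norm]
  refine (hu.norm_sub_le_gronwallBound hT
    (huε.solves ε hε) hm (hmε ε hε) hM0 (hMε ε hε) ?_ hτ).trans_lt hlt
  simp only [C, hG ε hε]
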